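/- Consider $n\ge 1$ agents and finitely many topics. For every pair of distinct agents $i,j$ let $K^{i,j}=[k^{i,j}_{p,q}]$ be a constant coupling matrix indexed by the topics, with $k^{i,j}_{p,q}\ge 0$ and $k^{i,j}_{p,q}=k^{j,i}_{p,q}=k^{i,j}_{q,p}$; topics $p$ and $q$ are coupled between $i$ and $j$ if $k^{i,j}_{p,q}\neq 0$. Agents $i\neq j$ are neighbors ($j\in\mathcal N_i$) if $K^{i,j}\ne 0$. Fix $k_e>0$ and put $\mathrm{sign}(y)=\frac{2}{1+e^{-k_e y}}-1$. Let $x_{i,p}$ be the opinion of agent $i$ on topic $p$, and let $x$ be the vector of all opinions. Define the weighting matrices $$A^{i,j}(x)=[a^{i,j}_{p,q}],\qquad a^{i,j}_{p,q}=k^{i,j}_{p,q}\,\mathrm{sign}(x_{j,p}-x_{i,p})\,\mathrm{sign}(x_{j,q}-x_{i,q})$$ (for all $p,q$, including $p=q$). Let $\mathbb L(x)$ be the block matrix with diagonal blocks $\sum_{j\in\mathcal N_i}A^{i,j}(x)$, with off-diagonal blocks $-A^{i,j}(x)$ for neighbors $i,j$, and with zero blocks otherwise. The opinions evolve by $$\dot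 x=-\mathbb L(x)\,x,\qquad\text{that is,}\qquad \dot x_i=\sum_{j\in\mathcal N_i}A^{i,j}(x)(x_j-x_i),\qquad t\ge 0.$$ For a topic $p$, the topic consensus graph $\mathcal G_{p,con}$ has one vertex $x_{i,p}$ for each agent $i$; the vertices of two distinct agents $i,j$ are adjacent if and only if $k^{i,j}_{p,q}\ne 0$ for some topic $q$ (possibly $q=p$). Theorem. Assume that the Laplacian $\mathbb L(x)$ is (symmetric) positive semidefinite for every state $x$. Then for each topic $p$, the $p$-th opinions of all agents reach a consensus, i.e. $x_{i,p}(t)-x_{j,p}(t)\to 0$ as $t\to\infty$ for all agents $i,j$ along every solution on $[0,\infty)$, whatever the initial opinions, if and only if $\mathcal G_{p,con}$ is connected. -/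

import Mathlib

open Filter Topology

/-- The data of a cooperative opinion network with agent set `V` and topic set `T`: a constant
coupling matrix `K^{i,j}` for every pair of agents. A positive entry `k_{p,q}^{i,j}` means that the
topics `p` and `q` of the agents `i` and `j` are coupled, a zero entry that they are not. -/
structure OpinionNetwork (V T : Type*) where
  /-- `coupling i j p q` is the entry `k_{p,q}^{i,j}`. -/
  coupling : V → V → Matrix T T ℝ
  nonneg : ∀ i j p q, 0 ≤ coupling i j p q
  symm_agents : ∀ i j p q, coupling i j p q = coupling j i p q
  symm_topics : ∀ i j p q, coupling i j p q = coupling i j q p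

/-- The continuous sign function `2 / (1 + e^{-k y}) - 1` with gain `k`. -/
noncomputable def sigmoidSign (k y : ℝ) : ℝ := 2 / (1 + Real.exp (-k * y)) - 1

namespace OpinionNetwork

variable {V T : Type*}

/-- Two distinct agents are connected when at least one pair of their topics is coupled. -/
def interactionGraph (N : OpinionNetwork V T) : SimpleGraph V where
  Adj i j := i ≠ j ∧ ∃ p q, N.coupling i j p q ≠ 0
  symm := ⟨by
    rintro i j ⟨hij, p, q, h⟩
    exact ⟨hij.symm, p, q, by rwa [← N.symm_agents i j p q]⟩⟩
  loopless := ⟨fun _ h => h.1 rfl⟩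

/-- The state-dependent weighting matrix `A^{i,j}(x)` of inverse-proportional feedback, with entries
`k_{p,q}^{i,j} sign(x_{j,p} - x_{i,p}) sign(x_{j,q} - x_{i,q})`.
A state `x` lists all opinions, `x (i, p)` being the opinion of agent `i` on topic `p`. -/
noncomputable def weight (N : OpinionNetwork V T) (k : ℝ) (x : V × T → ℝ) (i j : V) :
    Matrix T T ℝ :=
  Matrix.of fun p q =>
    N.coupling i j p q * sigmoidSign k (x (j, p) - x (i, p)) * sigmoidSign k (x (j, q) - x (i, q))

open Classical in
/-- The matrix-weighted Laplacian `𝕃(x)`: its `(i, i)` block is the sum of `A^{i,j}(x)` over the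
neighbors `j` of `i`, and its `(i, j)` block for `i ≠ j` is `-A^{i,j}(x)` if `j` is a neighbor of
`i` and zero otherwise. -/
noncomputable def laplacian [Fintype V] (N : OpinionNetwork V T) (k : ℝ) (x : V × T → ℝ) :
    Matrix (V × T) (V × T) ℝ :=
  Matrix.of fun a b =>
    if a.1 = b.1 then ∑ j ∈ N.interactionGraph.neighborFinset a.1, N.weight k x a.1 j a.2 b.2
    else if N.interactionGraph.Adj a.1 b.1 then -N.weight k x a.1 b.1 a.2 b.2
    else 0

/-- `x` solves the opinion dynamics `ẋ = -𝕃(x) x` on `[0, ∞)`. -/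
def IsTrajectory [Fintype V] [Fintype T] (N : OpinionNetwork V T) (k : ℝ)
    (x : ℝ → V × T → ℝ) : Prop :=
  ∀ t, 0 ≤ t →
    HasDerivWithinAt x (-((N.laplacian k (x t)).mulVec (x t))) (Set.Ici 0) t

/-- The opinions of all agents on topic `p` reach a consensus, whatever the initial opinions. -/
def ReachesConsensus [Fintype V] [Fintype T] (N : OpinionNetwork V T) (k : ℝ) (p : T) : Prop :=
  ∀ x : ℝ → V × T → ℝ, N.IsTrajectory k x →
    ∀ i j : V, Tendsto (fun t => x t (i, p) - x t (j, p)) atTop (𝓝 0)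

open Classical in
/-- The diagonal entry `c_{p,p}^{i,j}` of the consensus matrix of the agents `i` and `j`: it is `1`
if topic `p` is coupled with some topic `q` (`q = p` included) between `i` and `j`, and `0`
otherwise. -/
noncomputable def consensusEntry (N : OpinionNetwork V T) (i j : V) (p : T) : ℕ :=
  if ∃ q, N.coupling i j p q ≠ 0 then 1 else 0

/-- The topic consensus graph `𝒢_{p,con}`; its vertex `i` stands for the opinion `x_{i,p}`. -/
def topicConsensusGraph (N : OpinionNetwork V T) (p : T) : SimpleGraph V where
  Adj i j := N.interactionGraph.Adj i j ∧ N.consensusEntry i j p = 1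
  symm := ⟨by
    rintro i j ⟨hij, h⟩
    refine ⟨hij.symm, ?_⟩
    have e : N.coupling j i = N.coupling i j := by
      ext a b
      exact N.symm_agents j i a b
    unfold consensusEntry at h ⊢
    rw [e]
    exact h⟩
  loopless := ⟨fun _ h => h.1.1 rfl⟩

end OpinionNetwork

/-!
Consensus on a topic of a matrix-weighted opinion network is equivalent to connectedness of the
topic consensus graph.

Necessity needs only equilibria. If the graph is disconnected, the state that equals `1` on topic
`p` for the agents of one component and `0` elsewhere is an equilibrium without consensus
(`exists_equilibrium_of_not_reachable`), because agents of different components have no coupling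
that involves topic `p`.

For sufficiency, write `d = x_j - x_i`. The quadratic form `x ⬝ᵥ 𝕃(x) x` is the sum over the edges
of the terms `k_{p,q} (sign(d_p) d_p) (sign(d_q) d_q)`, all nonnegative since `y * sign y ≥ 0`.
So the squared norm of a trajectory decreases at a rate of at least
`k_{p,p} (sign(d_p) d_p) ^ 2` for every edge (`coupling_mul_sq_le`). An edge of the topic consensus
graph is only known to have some `k_{p,q} ≠ 0`; here positive semidefiniteness enters, giving
`k_{p,q} ^ 2 ≤ k_{p,p} k_{q,q}` (`coupling_sq_le`) and hence `k_{p,p} > 0`. Trajectories are bounded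
and therefore Lipschitz, so a Barbalat-type argument (`tendsto_zero_of_dissipation`) gives
`d_p → 0` along each edge, and connectedness extends this to all pairs of agents.
-/

/-! ### The smooth sign function -/

theorem continuous_sigmoidSign (k : ℝ) : Continuous (sigmoidSign k) := by
  unfold sigmoidSign
  refine Continuous.sub (Continuous.div (by fun_prop) (by fun_prop) fun y => ?_) (by fun_prop)
  positivity

theorem sigmoidSign_zero (k : ℝ) : sigmoidSign k 0 = 0 := by
  norm_num [sigmoidSign]

theorem sigmoidSign_neg (k y : ℝ) : sigmoidSign k (-y) = -sigmoidSign k y := by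
  have h : Real.exp (-k * -y) = (Real.exp (-k * y))⁻¹ := by
    rw [← Real.exp_neg]; ring_nf
  have h0 := Real.exp_pos (-k * y)
  unfold sigmoidSign
  rw [h]
  field_simp
  ring

theorem sigmoidSign_monotone {k : ℝ} (hk : 0 ≤ k) : Monotone (sigmoidSign k) := by
  intro y z hyz
  unfold sigmoidSign
  have : Real.exp (-k * z) ≤ Real.exp (-k * y) := by
    apply Real.exp_le_exp.2
    nlinarith
  gcongr

theorem sigmoidSign_pos {k y : ℝ} (hk : 0 < k) (hy : 0 < y) : 0 < sigmoidSign k y := by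
  have h : Real.exp (-k * y) < 1 := by
    rw [Real.exp_lt_one_iff]
    nlinarith
  have h0 := Real.exp_pos (-k * y)
  unfold sigmoidSign
  rw [sub_pos, lt_div_iff₀ (by positivity)]
  linarith

theorem sigmoidSign_mul_self_nonneg {k : ℝ} (hk : 0 ≤ k) (y : ℝ) : 0 ≤ sigmoidSign k y * y := by
  rcases le_total 0 y with hy | hy
  · exact mul_nonneg (sigmoidSign_zero k ▸ sigmoidSign_monotone hk hy) hy
  · exact mul_nonneg_of_nonpos_of_nonpos (sigmoidSign_zero k ▸ sigmoidSign_monotone hk hy) hy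

/-- Away from the origin, `y * sign y` is bounded below by its value at the cut-off. -/
theorem sigmoidSign_mul_self_le {k ε y : ℝ} (hk : 0 ≤ k) (hε : 0 ≤ ε) (hy : ε ≤ |y|) :
    sigmoidSign k ε * ε ≤ sigmoidSign k y * y := by
  have h : sigmoidSign k y * y = sigmoidSign k |y| * |y| := by
    rcases abs_cases y with ⟨h, -⟩ | ⟨h, -⟩ <;> rw [h]
    rw [sigmoidSign_neg, neg_mul_neg]
  rw [h]
  have h0 : 0 ≤ sigmoidSign k ε := sigmoidSign_zero k ▸ sigmoidSign_monotone hk hε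
  have h1 := sigmoidSign_monotone hk hy
  exact mul_le_mul h1 hy hε (h0.trans h1)

/-! ### A Barbalat-type lemma -/

/-- If `E ≥ 0` decreases at rate at least `φ (d t)`, with `φ ≥ 0` bounded away from zero off every
neighbourhood of the origin, and `d` is Lipschitz, then `d` tends to zero: each excursion of `d`
above `ε` lasts for a fixed time and would cost a fixed amount of `E`, whereas `E` converges. -/
theorem tendsto_zero_of_dissipation {E E' d : ℝ → ℝ} {φ : ℝ → ℝ} {C : ℝ}
    (hE : ∀ t, 0 ≤ t → HasDerivWithinAt E (E' t) (Set.Ici 0) t) (hE0 : ∀ t, 0 ≤ E t)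
    (hE' : ∀ t, 0 ≤ t → E' t ≤ -φ (d t)) (hφ0 : ∀ y, 0 ≤ φ y)
    (hφ : ∀ ε, 0 < ε → ∃ c, 0 < c ∧ ∀ y, ε ≤ |y| → c ≤ φ y)
    (hd : ∀ s t, 0 ≤ s → s ≤ t → |d t - d s| ≤ C * (t - s)) :
    Tendsto d atTop (𝓝 0) := by
  have drop : ∀ c s t, 0 ≤ s → s ≤ t → (∀ u ∈ Set.Ioo s t, E' u ≤ -c) →
      E t - E s ≤ -c * (t - s) := by
    intro c s t hs hst hc
    have hder : ∀ u ∈ interior (Set.Icc s t), HasDerivAt E (E' u) u := by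
      intro u hu
      rw [interior_Icc] at hu
      have : 0 < u := hs.trans_lt hu.1
      exact (hE u this.le).hasDerivAt (Ici_mem_nhds this)
    refine Convex.image_sub_le_mul_sub_of_deriv_le (convex_Icc s t) ?_ ?_ ?_ s
      (Set.left_mem_Icc.2 hst) t (Set.right_mem_Icc.2 hst) hst
    · intro u hu
      exact ((hE u (hs.trans hu.1)).continuousWithinAt).mono
        fun v hv => hs.trans hv.1
    · exact fun u hu => (hder u hu).differentiableAt.differentiableWithinAt
    · intro u hu
      rw [(hder u hu).deriv]
      exact hc u (by rwa [interior_Icc] at hu)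
  have anti : Antitone fun t => E (max t 0) := by
    intro s t hst
    have := drop 0 (max s 0) (max t 0) (le_max_right _ _) (max_le_max_right 0 hst) fun u hu => by
      have h := hE' u ((le_max_right s 0).trans hu.1.le)
      linarith [hφ0 (d u)]
    simp only [neg_zero, zero_mul] at this
    exact sub_nonpos.1 this
  have lim := tendsto_atTop_ciInf anti ⟨0, by rintro _ ⟨t, rfl⟩; exact hE0 _⟩
  rw [Metric.tendsto_atTop]
  intro ε hε
  obtain ⟨c, hc, hφc⟩ := hφ (ε / 2) (half_pos hε)
  -- Within time `δ` the function `d` moves by at most `ε / 2`.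
  set δ := ε / (2 * (|C| + 1)) with hδ
  have hδ0 : 0 < δ := by positivity
  have hCδ : C * δ ≤ ε / 2 := by
    have : (|C| + 1) * δ = ε / 2 := by rw [hδ]; field_simp
    nlinarith [le_abs_self C]
  have lim' : Tendsto (fun t => E (max t 0) - E (max (t + δ) 0)) atTop (𝓝 0) := by
    simpa using lim.sub (lim.comp (tendsto_atTop_add_const_right atTop δ tendsto_id))
  obtain ⟨t₀, ht₀⟩ := ((lim'.eventually_lt_const (by positivity : 0 < c * δ)).and
    (eventually_ge_atTop 0)).exists_forall_of_atTop
  refine ⟨t₀, fun t ht => ?_⟩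
  obtain ⟨h1, h2⟩ := ht₀ t ht
  rw [max_eq_left h2, max_eq_left (by positivity)] at h1
  rw [Real.dist_eq, sub_zero]
  by_contra! hcon
  have := drop c t (t + δ) h2 (by linarith) fun u hu => by
    have hu0 : 0 ≤ u := h2.trans hu.1.le
    have h3 := hd t u h2 hu.1.le
    have h4 : C * (u - t) ≤ ε / 2 := by
      rcases le_total 0 C with h | h
      · nlinarith [hu.2]
      · nlinarith [hu.1]
    have h5 : |d t| ≤ |d u| + |d u - d t| := by
      have := abs_sub_abs_le_abs_sub (d t) (d u)
      rw [abs_sub_comm] at this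
      linarith
    linarith [hE' u hu0, hφc (d u) (by linarith)]
  rw [add_sub_cancel_left] at this
  linarith

namespace OpinionNetwork

variable {V T : Type*}

/-! ### The Laplacian and its quadratic form -/

theorem weight_swap (N : OpinionNetwork V T) (k : ℝ) (x : V × T → ℝ) (i j : V) (p q : T) :
    N.weight k x j i p q = N.weight k x i j p q := by
  simp only [weight, Matrix.of_apply]
  rw [N.symm_agents j i, ← neg_sub (x (j, p)), ← neg_sub (x (j, q)), sigmoidSign_neg,
    sigmoidSign_neg]
  ring

open Classical in
theorem laplacian_mulVec_apply [Fintype V] [Fintype T] (N : OpinionNetwork V T) (k : ℝ)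
    (x y : V × T → ℝ) (i : V) (p : T) :
    (N.laplacian k x).mulVec y (i, p) =
      ∑ j, if N.interactionGraph.Adj i j then
        ∑ q, N.weight k x i j p q * (y (i, q) - y (j, q)) else 0 := by
  have split : ∀ l q, N.laplacian k x (i, p) (l, q) =
      (if i = l then ∑ j, (if N.interactionGraph.Adj i j then N.weight k x i j p q else 0) else 0)
      - if N.interactionGraph.Adj i l then N.weight k x i l p q else 0 := by
    intro l q
    simp only [laplacian, Matrix.of_apply, SimpleGraph.neighborFinset_eq_filter,
      Finset.sum_filter]
    by_cases h : i = l
    · subst h; simp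
    · by_cases h' : N.interactionGraph.Adj i l <;> simp [h, h']
  rw [Matrix.mulVec, dotProduct, Fintype.sum_prod_type]
  simp only [split, sub_mul, Finset.sum_sub_distrib, mul_sub, ite_mul, zero_mul]
  rw [Finset.sum_comm]
  simp only [Finset.sum_ite_eq, Finset.mem_univ, if_true, Finset.sum_mul]
  rw [Finset.sum_comm, ← Finset.sum_sub_distrib]
  refine Finset.sum_congr rfl fun j _ => ?_
  split_ifs <;> simp

open Classical in
/-- The quadratic form of the Laplacian is a sum over the ordered pairs of neighbors, each edge
being counted twice. -/
theorem two_mul_dotProduct_laplacian_mulVec [Fintype V] [Fintype T] (N : OpinionNetwork V T)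
    (k : ℝ) (x : V × T → ℝ) :
    2 * (x ⬝ᵥ (N.laplacian k x).mulVec x) =
      ∑ i, ∑ j, if N.interactionGraph.Adj i j then
        ∑ p, ∑ q, N.weight k x i j p q * (x (j, p) - x (i, p)) * (x (j, q) - x (i, q)) else 0 := by
  have h1 : x ⬝ᵥ (N.laplacian k x).mulVec x = ∑ i, ∑ j, if N.interactionGraph.Adj i j then
      ∑ p, ∑ q, x (i, p) * (N.weight k x i j p q * (x (i, q) - x (j, q))) else 0 := by
    rw [dotProduct, Fintype.sum_prod_type]
    refine Finset.sum_congr rfl fun i _ => ?_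
    simp only [laplacian_mulVec_apply, Finset.mul_sum]
    rw [Finset.sum_comm]
    refine Finset.sum_congr rfl fun j _ => ?_
    split_ifs <;> simp [Finset.mul_sum]
  have h2 : x ⬝ᵥ (N.laplacian k x).mulVec x = ∑ i, ∑ j, if N.interactionGraph.Adj i j then
      ∑ p, ∑ q, x (j, p) * (N.weight k x i j p q * (x (j, q) - x (i, q))) else 0 := by
    rw [h1, Finset.sum_comm]
    refine Finset.sum_congr rfl fun i _ => Finset.sum_congr rfl fun j _ => ?_
    simp only [N.weight_swap k x i j, N.interactionGraph.adj_comm j i]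
  rw [two_mul]
  nth_rewrite 1 [h1]
  rw [h2, ← Finset.sum_add_distrib]
  refine Finset.sum_congr rfl fun i _ => ?_
  rw [← Finset.sum_add_distrib]
  refine Finset.sum_congr rfl fun j _ => ?_
  split_ifs
  · simp only [← Finset.sum_add_distrib]
    refine Finset.sum_congr rfl fun p _ => Finset.sum_congr rfl fun q _ => ?_
    ring
  · simp

theorem weight_mul_mul_nonneg (N : OpinionNetwork V T) {k : ℝ} (hk : 0 ≤ k) (x : V × T → ℝ)
    (i j : V) (p q : T) :
    0 ≤ N.weight k x i j p q * (x (j, p) - x (i, p)) * (x (j, q) - x (i, q)) := by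
  have h := mul_nonneg (N.nonneg i j p q) (mul_nonneg
    (sigmoidSign_mul_self_nonneg hk (x (j, p) - x (i, p)))
    (sigmoidSign_mul_self_nonneg hk (x (j, q) - x (i, q))))
  simp only [weight, Matrix.of_apply]
  linarith only [h]

/-- All terms of the quadratic form being nonnegative, it dominates each of them. -/
theorem coupling_mul_sq_le [Fintype V] [Fintype T] (N : OpinionNetwork V T) {k : ℝ} (hk : 0 ≤ k)
    (x : V × T → ℝ) {i j : V} (hij : N.interactionGraph.Adj i j) (p : T) :
    N.coupling i j p p * (sigmoidSign k (x (j, p) - x (i, p)) * (x (j, p) - x (i, p))) ^ 2 ≤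
      2 * (x ⬝ᵥ (N.laplacian k x).mulVec x) := by
  classical
  rw [two_mul_dotProduct_laplacian_mulVec]
  have h0 := N.weight_mul_mul_nonneg hk x
  have h1 : ∀ i j, 0 ≤ if N.interactionGraph.Adj i j then
      ∑ p, ∑ q, N.weight k x i j p q * (x (j, p) - x (i, p)) * (x (j, q) - x (i, q)) else 0 := by
    intro i j
    split_ifs
    · exact Finset.sum_nonneg fun p _ => Finset.sum_nonneg fun q _ => h0 i j p q
    · exact le_rfl
  refine le_trans ?_ (Finset.single_le_sum
    (fun i _ => Finset.sum_nonneg fun j _ => h1 i j) (Finset.mem_univ i))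
  refine le_trans ?_ (Finset.single_le_sum (fun j _ => h1 i j) (Finset.mem_univ j))
  rw [if_pos hij]
  refine le_trans ?_ (Finset.single_le_sum
    (fun p _ => Finset.sum_nonneg fun q _ => h0 i j p q) (Finset.mem_univ p))
  refine le_trans (le_of_eq ?_) (Finset.single_le_sum (fun q _ => h0 i j p q) (Finset.mem_univ p))
  simp only [weight, Matrix.of_apply]
  ring

/-- Positive semidefiniteness of the Laplacian at every state forces each coupling matrix to obey
the Cauchy–Schwarz bound. At the state in which only agent `j` differs from the others, the block
of the Laplacian at `(i, i)` is a positive multiple of `K^{i,j}`. -/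
theorem coupling_sq_le [Fintype V] (N : OpinionNetwork V T) {k : ℝ} (hk : 0 < k)
    (hL : ∀ x : V × T → ℝ, (N.laplacian k x).PosSemidef) {i j : V}
    (hij : N.interactionGraph.Adj i j) (p q : T) :
    N.coupling i j p q ^ 2 ≤ N.coupling i j p p * N.coupling i j q q := by
  classical
  set x : V × T → ℝ := fun a => if a.1 = j then 1 else 0 with hx
  have hne : i ≠ j := hij.ne
  have entry : ∀ r s, N.laplacian k x (i, r) (i, s) =
      N.coupling i j r s * sigmoidSign k 1 * sigmoidSign k 1 := by
    intro r s
    simp only [laplacian, Matrix.of_apply, if_true]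
    rw [Finset.sum_eq_single j]
    · simp [weight, hx, hne]
    · intro l _ hl
      simp [weight, hx, hne, hl, sigmoidSign_zero]
    · intro h
      exact absurd ((N.interactionGraph.mem_neighborFinset i j).2 hij) h
  have hdet := ((hL x).submatrix ![(i, p), (i, q)]).det_nonneg
  simp only [Matrix.det_fin_two, Matrix.submatrix_apply, Matrix.cons_val_zero,
    Matrix.cons_val_one, entry, N.symm_topics i j q p] at hdet
  have hs : 0 < sigmoidSign k 1 ^ 4 := pow_pos (sigmoidSign_pos hk one_pos) 4
  nlinarith

theorem coupling_self_pos [Fintype V] (N : OpinionNetwork V T) {k : ℝ} (hk : 0 < k)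
    (hL : ∀ x : V × T → ℝ, (N.laplacian k x).PosSemidef) {i j : V} {p : T}
    (hij : (N.topicConsensusGraph p).Adj i j) : 0 < N.coupling i j p p := by
  obtain ⟨hadj, hc⟩ := hij
  have hq : ∃ q, N.coupling i j p q ≠ 0 := by
    by_contra h
    simp [consensusEntry, h] at hc
  obtain ⟨q, hq⟩ := hq
  refine lt_of_le_of_ne (N.nonneg i j p p) fun h => hq ?_
  have := N.coupling_sq_le hk hL hadj p q
  rw [← h, zero_mul] at this
  exact pow_eq_zero_iff two_ne_zero |>.1 (le_antisymm this (sq_nonneg _))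

/-! ### Boundedness and convergence of trajectories -/

theorem continuous_laplacian_mulVec [Fintype V] [Fintype T] (N : OpinionNetwork V T) (k : ℝ) :
    Continuous fun x : V × T → ℝ => (N.laplacian k x).mulVec x := by
  classical
  refine continuous_pi fun a => ?_
  have hw : ∀ i j p q, Continuous fun x : V × T → ℝ => N.weight k x i j p q := by
    intro i j p q
    simp only [weight, Matrix.of_apply]
    have := continuous_sigmoidSign k
    fun_prop
  refine (continuous_congr fun x => N.laplacian_mulVec_apply k x x a.1 a.2).2 ?_
  refine continuous_finsetSum _ fun j _ => ?_
  split_ifs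
  · exact continuous_finsetSum _ fun q _ => (hw _ _ _ _).mul (by fun_prop)
  · exact continuous_const

theorem IsTrajectory.hasDerivWithinAt_dotProduct [Fintype V] [Fintype T]
    {N : OpinionNetwork V T} {k : ℝ} {x : ℝ → V × T → ℝ} (hx : N.IsTrajectory k x) {t : ℝ}
    (ht : 0 ≤ t) :
    HasDerivWithinAt (fun t => x t ⬝ᵥ x t) (-(2 * (x t ⬝ᵥ (N.laplacian k (x t)).mulVec (x t))))
      (Set.Ici 0) t := by
  have h := hasDerivWithinAt_pi.1 (hx t ht)
  have := HasDerivWithinAt.fun_sum (u := Finset.univ) fun a _ => (h a).mul (h a)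
  refine this.congr_deriv ?_
  simp only [dotProduct, Pi.neg_apply, Finset.mul_sum, ← Finset.sum_neg_distrib]
  exact Finset.sum_congr rfl fun a _ => by ring

theorem IsTrajectory.dotProduct_self_le [Fintype V] [Fintype T] {N : OpinionNetwork V T} {k : ℝ}
    (hL : ∀ x : V × T → ℝ, (N.laplacian k x).PosSemidef) {x : ℝ → V × T → ℝ}
    (hx : N.IsTrajectory k x) {t : ℝ} (ht : 0 ≤ t) : x t ⬝ᵥ x t ≤ x 0 ⬝ᵥ x 0 := by
  have anti : AntitoneOn (fun t => x t ⬝ᵥ x t) (Set.Ici 0) := by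
    refine antitoneOn_of_hasDerivWithinAt_nonpos (convex_Ici 0)
      (fun s hs => (hx.hasDerivWithinAt_dotProduct hs).continuousWithinAt)
      (f' := fun s => -(2 * (x s ⬝ᵥ (N.laplacian k (x s)).mulVec (x s)))) ?_ ?_
    · intro s hs
      exact (hx.hasDerivWithinAt_dotProduct (interior_subset hs)).mono interior_subset
    · intro s _
      have := (hL (x s)).dotProduct_mulVec_nonneg (x s)
      simp only [star_trivial] at this
      linarith
  exact anti Set.self_mem_Ici ht ht

/-- Trajectories stay bounded, hence have bounded velocity. -/
theorem IsTrajectory.exists_lipschitz [Fintype V] [Fintype T] {N : OpinionNetwork V T} {k : ℝ}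
    (hL : ∀ x : V × T → ℝ, (N.laplacian k x).PosSemidef) {x : ℝ → V × T → ℝ}
    (hx : N.IsTrajectory k x) :
    ∃ C, ∀ s t, 0 ≤ s → s ≤ t → ‖x t - x s‖ ≤ C * (t - s) := by
  set R := √(x 0 ⬝ᵥ x 0) with hR
  have hball : ∀ t, 0 ≤ t → x t ∈ Metric.closedBall 0 R := by
    intro t ht
    rw [mem_closedBall_zero_iff, pi_norm_le_iff_of_nonneg (Real.sqrt_nonneg _)]
    intro a
    rw [Real.norm_eq_abs]
    refine Real.abs_le_sqrt (le_trans ?_ (hx.dotProduct_self_le hL ht))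
    rw [sq]
    exact Finset.single_le_sum (f := fun a => x t a * x t a)
      (fun b _ => mul_self_nonneg _) (Finset.mem_univ a)
  obtain ⟨C, hC⟩ := (isCompact_closedBall (0 : V × T → ℝ) R).exists_bound_of_continuousOn
    (N.continuous_laplacian_mulVec k).continuousOn
  refine ⟨C, fun s t hs hst => ?_⟩
  have := (convex_Ici (0 : ℝ)).norm_image_sub_le_of_norm_hasDerivWithin_le
    (fun u hu => hx u hu) (fun u hu => by rw [norm_neg]; exact hC _ (hball u hu))
    hs (hs.trans hst : 0 ≤ t)
  rwa [Real.norm_of_nonneg (sub_nonneg.2 hst)] at this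

theorem IsTrajectory.tendsto_of_adj [Fintype V] [Fintype T] {N : OpinionNetwork V T} {k : ℝ}
    (hk : 0 < k) (hL : ∀ x : V × T → ℝ, (N.laplacian k x).PosSemidef) {x : ℝ → V × T → ℝ}
    (hx : N.IsTrajectory k x) {i j : V} {p : T} (hij : (N.topicConsensusGraph p).Adj i j) :
    Tendsto (fun t => x t (j, p) - x t (i, p)) atTop (𝓝 0) := by
  have hpos := N.coupling_self_pos hk hL hij
  obtain ⟨C, hC⟩ := hx.exists_lipschitz hL
  refine tendsto_zero_of_dissipation (C := 2 * C)
    (φ := fun y => N.coupling i j p p * (sigmoidSign k y * y) ^ 2)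
    (fun t ht => hx.hasDerivWithinAt_dotProduct ht)
    (fun t => Finset.sum_nonneg fun a _ => mul_self_nonneg _)
    (fun t _ => neg_le_neg (N.coupling_mul_sq_le hk.le (x t) hij.1 p))
    (fun y => by positivity) ?_ ?_
  · intro ε hε
    have hs := sigmoidSign_pos hk hε
    refine ⟨N.coupling i j p p * (sigmoidSign k ε * ε) ^ 2, by positivity, fun y hy => ?_⟩
    have := sigmoidSign_mul_self_le hk.le hε.le hy
    gcongr
  · intro s t hs hst
    have h := hC s t hs hst
    have h1 := (norm_le_pi_norm (x t - x s) (j, p)).trans h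
    have h2 := (norm_le_pi_norm (x t - x s) (i, p)).trans h
    rw [Pi.sub_apply, Real.norm_eq_abs] at h1 h2
    calc |x t (j, p) - x t (i, p) - (x s (j, p) - x s (i, p))|
        = |(x t (j, p) - x s (j, p)) - (x t (i, p) - x s (i, p))| := by ring_nf
      _ ≤ _ := abs_sub _ _
      _ ≤ 2 * C * (t - s) := by linarith

theorem reachesConsensus_of_connected [Fintype V] [Fintype T] {N : OpinionNetwork V T} {k : ℝ}
    (hk : 0 < k) (hL : ∀ x : V × T → ℝ, (N.laplacian k x).PosSemidef) {p : T}
    (hG : (N.topicConsensusGraph p).Connected) : N.ReachesConsensus k p := by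
  intro x hx i j
  obtain ⟨w⟩ := hG.preconnected i j
  induction w with
  | nil => simp
  | cons h _ ih => simpa using ih.sub (hx.tendsto_of_adj hk hL h)

/-! ### Disconnected equilibria -/

/-- Lifting the `p`-th opinion of exactly the agents reachable from `i` in the topic consensus
graph gives an equilibrium: agents whose opinions differ have no coupling involving topic `p`. -/
theorem exists_equilibrium_of_not_reachable [Fintype V] [Fintype T] (N : OpinionNetwork V T)
    (k : ℝ) {p : T} {i j : V} (hij : ¬(N.topicConsensusGraph p).Reachable i j) :
    ∃ x : V × T → ℝ, (N.laplacian k x).mulVec x = 0 ∧ x (i, p) - x (j, p) ≠ 0 := by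
  classical
  refine ⟨fun a => if a.2 = p ∧ (N.topicConsensusGraph p).Reachable i a.1 then 1 else 0, ?_, ?_⟩
  · ext ⟨l, r⟩
    rw [laplacian_mulVec_apply]
    refine Finset.sum_eq_zero fun m _ => ?_
    split_ifs with hadj
    · refine Finset.sum_eq_zero fun q _ => ?_
      by_cases hq : q = p
      swap
      · simp [hq]
      subst hq
      by_cases hc : N.coupling l m q r = 0
      · rw [weight, Matrix.of_apply, N.symm_topics l m r q, hc]
        simp
      · have h : (N.topicConsensusGraph q).Adj l m := ⟨hadj, if_pos ⟨r, hc⟩⟩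
        have : (N.topicConsensusGraph q).Reachable i l ↔ (N.topicConsensusGraph q).Reachable i m :=
          ⟨fun h' => h'.trans h.reachable, fun h' => h'.trans h.symm.reachable⟩
        simp [this]
    · rfl
  · simp [hij]

theorem connected_of_reachesConsensus [Fintype V] [Nonempty V] [Fintype T]
    {N : OpinionNetwork V T} {k : ℝ} {p : T} (h : N.ReachesConsensus k p) :
    (N.topicConsensusGraph p).Connected := by
  refine (SimpleGraph.connected_iff _).2 ⟨fun i j => ?_, inferInstance⟩
  by_contra hij
  obtain ⟨x, hx, hne⟩ := N.exists_equilibrium_of_not_reachable k hij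
  have htraj : N.IsTrajectory k fun _ => x := by
    intro t _
    rw [hx, neg_zero]
    exact hasDerivWithinAt_const ..
  exact hne (tendsto_nhds_unique tendsto_const_nhds (h _ htraj i j))

end OpinionNetwork

theorem mainTheorem2 {V T : Type*} [Fintype V] [Nonempty V] [Fintype T]
    (N : OpinionNetwork V T) (k : ℝ) (hk : 0 < k)
    (hL : ∀ x : V × T → ℝ, (N.laplacian k x).PosSemidef) (p : T) :
    N.ReachesConsensus k p ↔ (N.topicConsensusGraph p).Connected :=
  ⟨OpinionNetwork.connected_of_reachesConsensus, OpinionNetwork.reachesConsensus_of_connected hk hL⟩
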